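/- All algebras have a fixed similarity type of finitary operations; $\operatorname{Con}(\mathbf A)$ is the congruence lattice of $\mathbf A$, and two congruences permute if $\theta\circ\psi=\psi\circ\theta$. A variety is a class of algebras closed under homomorphic images, (nonempty) subalgebras and direct products; it admits a lattice $\mathbf L$ if $\mathbf L$ is isomorphic to a sublattice of $\operatorname{Con}(\mathbf A)$ for some algebra $\mathbf A$ in the variety. Let $\mathbf M_3^i$ ($i\ge 1$) be copies of the five-element lattice $\mathbf M_3$, with bottom $\eta_i$, atoms $\alpha_i,\beta_i,\gamma_i$ and top $\delta_i$. The rods $\mathbf R_n$ and the snakes $\mathbf S_n$ are defined by $\mathbf R_1=\mathbf S_1=\mathbf M_3^1$ and: (a) $\mathbf R_{n+1}$ is obtained from $\mathbf R_n$ by glueing the filter $\{\gamma_n,\delta_n\}$ to the ideal $\{\eta_{n+1},\alpha_{n+1}\}$ of $\mathbf M_3^{n+1}$ (identifying $\gamma_n=\eta_{n+1}$ and $\delta_n=\alpha_{n+1}$); (b) $\mathbf S_{n+1}$ is obtained from $\mathbf S_n$ by glueing, for $n$ odd, $\{\gamma_n,\delta_n\}$ to $\{\eta_{n+1},\alpha_{n+1}\}$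 and, for $n$ even, $\{\alpha_n,\delta_n\}$ to $\{\eta_{n+1},\gamma_{n+1}\}$ (identifying bottom with bottom and top with top). The lattices $\mathbf R_n^*$ and $\mathbf S_n^*$ are obtained in the same way, except that the two edges in question are not identified but pulled apart: they become opposite edges of a four-element Boolean interval. So an edge $\{x_n<\delta_n\}$ and an edge $\{\eta_{n+1}<y_{n+1}\}$ are joined by $x_n<\eta_{n+1}$ and $\delta_n<y_{n+1}$, with $\delta_n\wedge\eta_{n+1}=x_n$ and $\delta_n\vee\eta_{n+1}=y_{n+1}$. Theorem. Let $\mathcal V$ be a variety containing an algebra $\mathbf A$ such that $\operatorname{Con}(\mathbf A)$ has a sublattice isomorphic to $\mathbf M_3$ whose elements are pairwise permuting congruences. Then, for every $n\ge 1$, $\mathcal V$ admits $\mathbf R_n$ and $\mathbf S_n$, and also $\mathbf R_n^*$ and $\mathbf S_n^*$. -/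

import Mathlib

open FirstOrder FirstOrder.Language CategoryTheory

universe u v w

namespace CongruenceLattices

/-! ### Algebras, varieties and congruences

The algebras are the structures of a language `L` without relation symbols. -/

section Algebras

variable (L : FirstOrder.Language.{u, v})

/-- The direct product of a family of structures, with coordinatewise operations. -/
instance piStructure {ι : Type*} (A : ι → Type*) [∀ i, L.Structure (A i)] :
    L.Structure (∀ i, A i) where
  funMap f x := fun i => Structure.funMap f (fun k => x k i)
  RelMap r x := ∀ i, Structure.RelMap r (fun k => x k i)

/-- A variety: a class of algebras of the same similarity type that is closed under homomorphic
images, (nonempty) subalgebras and direct products. -/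
structure IsVariety (V : Set (Bundled.{w} L.Structure)) : Prop where
  homImage : ∀ A ∈ V, ∀ (B : Bundled.{w} L.Structure) (f : A →[L] B),
    Function.Surjective f → B ∈ V
  subalgebra : ∀ A ∈ V, ∀ S : L.Substructure A, Nonempty S → Bundled.of (c := L.Structure) S ∈ V
  product : ∀ (ι : Type w) (A : ι → Bundled.{w} L.Structure), (∀ i, A i ∈ V) →
    Bundled.of (c := L.Structure) (∀ i, A i) ∈ V

/-- A congruence of an algebra: an equivalence relation compatible with all the operations. -/
@[ext]
structure Congruence (A : Type w) [L.Structure A] extends Setoid A where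
  compatible : ∀ {n : ℕ} (f : L.Functions n) (x y : Fin n → A),
    (∀ i, toSetoid (x i) (y i)) → toSetoid (Structure.funMap f x) (Structure.funMap f y)

variable {L}

namespace Congruence

variable {A : Type w} [L.Structure A]

theorem toSetoid_injective :
    Function.Injective (Congruence.toSetoid : Congruence L A → Setoid A) := by
  intro a b h
  cases a
  cases b
  congr

/-- Congruences are ordered by inclusion. -/
instance : PartialOrder (Congruence L A) :=
  PartialOrder.lift Congruence.toSetoid toSetoid_injective

instance : InfSet (Congruence L A) where
  sInf s :=
    { toSetoid := sInf (Congruence.toSetoid '' s)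
      compatible := by
        intro n f x y h
        rintro _ ⟨c, hc, rfl⟩
        exact c.compatible f x y (fun i => h i c.toSetoid ⟨c, hc, rfl⟩) }

/-- The congruence lattice of an algebra. -/
instance : CompleteLattice (Congruence L A) where
  __ := completeLatticeOfInf (Congruence L A) (fun s =>
    ⟨fun c hc => sInf_le (α := Setoid A) ⟨c, hc, rfl⟩,
     fun c hc => le_sInf (α := Setoid A) (by rintro _ ⟨d, hd, rfl⟩; exact hc hd)⟩)
  inf c d :=
    { toSetoid := c.toSetoid ⊓ d.toSetoid
      compatible := fun f x y h =>
        ⟨c.compatible f x y (fun i => (h i).1), d.compatible f x y (fun i => (h i).2)⟩ }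
  inf_le_left c d := inf_le_left (a := c.toSetoid) (b := d.toSetoid)
  inf_le_right c d := inf_le_right (a := c.toSetoid) (b := d.toSetoid)
  le_inf c d e h₁ h₂ := le_inf (α := Setoid A) h₁ h₂

/-- Two congruences permute if `θ ∘ ψ = ψ ∘ θ` as relations. -/
def Permute (θ ψ : Congruence L A) : Prop :=
  Relation.Comp θ.toSetoid ψ.toSetoid = Relation.Comp ψ.toSetoid θ.toSetoid

end Congruence

/-- The class `V` admits the lattice `K`: `K` is isomorphic to a sublattice of the congruence
lattice of some algebra in `V`. -/
def Admits (V : Set (Bundled.{w} L.Structure)) (K : Type*) [Lattice K] : Prop :=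
  ∃ A ∈ V, ∃ f : LatticeHom K (Congruence L A), Function.Injective f

end Algebras

/-! ### The lattice `M₃` -/

/-- The five elements of `M₃`: bottom `η`, the atoms `α`, `β`, `γ` from left to right, top `δ`. -/
inductive M3 : Type
  | η | α | β | γ | δ
  deriving DecidableEq

namespace M3

instance : Fintype M3 where
  elems := {η, α, β, γ, δ}
  complete := by intro x; cases x <;> decide

instance : LE M3 := ⟨fun x y => x = y ∨ x = η ∨ y = δ⟩

instance : DecidableLE M3 := fun x y => inferInstanceAs (Decidable (x = y ∨ x = η ∨ y = δ))

instance : Lattice M3 where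
  le_refl := by decide
  le_trans := by decide
  le_antisymm := by decide
  sup x y := if x ≤ y then y else if y ≤ x then x else δ
  le_sup_left := by decide
  le_sup_right := by decide
  sup_le := by decide
  inf x y := if x ≤ y then x else if y ≤ x then y else η
  inf_le_left := by decide
  inf_le_right := by decide
  le_inf := by decide

instance : BoundedOrder M3 where
  top := δ
  le_top := by decide
  bot := η
  bot_le := by decide

theorem isCoatom_α : IsCoatom α :=
  ⟨by decide, fun b h => by revert h; rw [lt_iff_le_not_ge]; revert b; decide⟩

theorem isCoatom_β : IsCoatom β :=
  ⟨by decide, fun b h => by revert h; rw [lt_iff_le_not_ge]; revert b; decide⟩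

theorem isCoatom_γ : IsCoatom γ :=
  ⟨by decide, fun b h => by revert h; rw [lt_iff_le_not_ge]; revert b; decide⟩

end M3

/-! ### Glueing along an edge -/

/-- For a coatom `c` of `K` and an atom `a` of `M`: the lattice obtained by placing `M` above `K`
and glueing the filter `{c, ⊤}` of `K` to the ideal `{⊥, a}` of `M` (with `c` identified with `⊥`
and `⊤` identified with `a`). Its elements are the elements of `K` and the elements of `M` outside
the ideal `{⊥, a}`. -/
inductive EdgeGlue {K M : Type} [Lattice K] [Lattice M] (c : K) (a : M) : Type
  | low (x : K) : EdgeGlue c a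
  | high (m : M) (h : ¬ m ≤ a) : EdgeGlue c a

namespace EdgeGlue

open Classical in
/-- The canonical copy of `M` in the glued lattice. -/
noncomputable def up {K M : Type} [Lattice K] [OrderTop K] [Lattice M] (c : K) (a : M) (m : M) :
    EdgeGlue c a :=
  if h : m ≤ a then low (if a ≤ m then ⊤ else c) else high m h

section Order

variable {K M : Type} [Lattice K] [Lattice M] {c : K} {a : M}

/-- The orders of `K` and `M`, together with `x ≤ m` for `x ∈ K` and `m ∈ M` whenever
`x ≤ c = ⊥ ≤ m` or `x ≤ ⊤ = a ≤ m`. -/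
protected def le : EdgeGlue c a → EdgeGlue c a → Prop
  | low x, low y => x ≤ y
  | low x, high m _ => x ≤ c ∨ a ≤ m
  | high _ _, low _ => False
  | high m _, high k _ => m ≤ k

instance : PartialOrder (EdgeGlue c a) where
  le := EdgeGlue.le
  le_refl x := by cases x <;> simp [EdgeGlue.le]
  le_trans x y z h₁ h₂ := by
    rcases x with x | ⟨x, hx⟩ <;> rcases y with y | ⟨y, hy⟩ <;> rcases z with z | ⟨z, hz⟩ <;>
      simp only [EdgeGlue.le] at h₁ h₂ ⊢
    · exact h₁.trans h₂
    · exact h₂.imp h₁.trans id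
    · exact h₁.imp id (fun h => h.trans h₂)
    · exact h₁.trans h₂
  le_antisymm x y h₁ h₂ := by
    rcases x with x | ⟨x, hx⟩ <;> rcases y with y | ⟨y, hy⟩ <;>
      simp only [EdgeGlue.le] at h₁ h₂
    · rw [le_antisymm h₁ h₂]
    · cases le_antisymm h₁ h₂
      rfl

@[simp] theorem low_le_low {x y : K} : (low x : EdgeGlue c a) ≤ low y ↔ x ≤ y := Iff.rfl

@[simp] theorem low_le_high {x : K} {m : M} {h : ¬ m ≤ a} :
    (low x : EdgeGlue c a) ≤ high m h ↔ x ≤ c ∨ a ≤ m := Iff.rfl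

@[simp] theorem high_le_low {x : K} {m : M} {h : ¬ m ≤ a} :
    ((high m h : EdgeGlue c a) ≤ low x) ↔ False := Iff.rfl

@[simp] theorem high_le_high {m k : M} {h : ¬ m ≤ a} {h' : ¬ k ≤ a} :
    ((high m h : EdgeGlue c a) ≤ high k h') ↔ m ≤ k := Iff.rfl

end Order

variable {K M : Type} [Lattice K] [OrderTop K] [Lattice M] [BoundedOrder M] {c : K} {a : M}

open Classical in
noncomputable instance : Lattice (EdgeGlue c a) where
  sup
    | low x, low y => low (x ⊔ y)
    | low x, high m h => high ((if x ≤ c then ⊥ else a) ⊔ m) (fun h' => h (le_sup_right.trans h'))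
    | high m h, low x => high ((if x ≤ c then ⊥ else a) ⊔ m) (fun h' => h (le_sup_right.trans h'))
    | high m h, high k _ => high (m ⊔ k) (fun h' => h (le_sup_left.trans h'))
  inf
    | low x, low y => low (x ⊓ y)
    | low x, high m _ => low (x ⊓ (if a ≤ m then ⊤ else c))
    | high m _, low x => low (x ⊓ (if a ≤ m then ⊤ else c))
    | high m _, high k _ => up c a (m ⊓ k)
  le_sup_left x y := by
    rcases x with x | ⟨x, hx⟩ <;> rcases y with y | ⟨y, hy⟩ <;> simp
    split_ifs with h <;> simp [h]
  le_sup_right x y := by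
    rcases x with x | ⟨x, hx⟩ <;> rcases y with y | ⟨y, hy⟩ <;> simp
    split_ifs with h <;> simp [h]
  sup_le x y z h₁ h₂ := by
    rcases x with x | ⟨x, hx⟩ <;> rcases y with y | ⟨y, hy⟩ <;> rcases z with z | ⟨z, hz⟩ <;>
      simp only [low_le_low, low_le_high, high_le_low, high_le_high, sup_le_iff] at h₁ h₂ ⊢
    · exact ⟨h₁, h₂⟩
    · tauto
    · split_ifs <;> simp_all
    · split_ifs <;> simp_all
    · exact ⟨h₁, h₂⟩
  inf_le_left x y := by
    rcases x with x | ⟨x, hx⟩ <;> rcases y with y | ⟨y, hy⟩ <;> simp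
    · split_ifs with h <;> simp [h]
    · unfold up
      split_ifs with h h' <;> simp_all
  inf_le_right x y := by
    rcases x with x | ⟨x, hx⟩ <;> rcases y with y | ⟨y, hy⟩ <;> simp
    · split_ifs with h <;> simp [h]
    · unfold up
      split_ifs with h h' <;> simp_all
  le_inf x y z h₁ h₂ := by
    rcases x with x | ⟨x, hx⟩ <;> rcases y with y | ⟨y, hy⟩ <;> rcases z with z | ⟨z, hz⟩ <;>
      simp only [low_le_low, low_le_high, high_le_low, high_le_high, up] at h₁ h₂ ⊢
    · exact le_inf h₁ h₂
    · split_ifs <;> simp_all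
    · split_ifs <;> simp_all
    · split_ifs with h h' <;> simp_all <;> tauto
    · have h : ¬ y ⊓ z ≤ a := fun h => hx ((le_inf h₁ h₂).trans h)
      simp [h, h₁, h₂]

noncomputable instance : OrderTop (EdgeGlue c a) where
  top := up c a ⊤
  le_top x := by
    unfold up
    rcases x with x | ⟨x, hx⟩ <;> split_ifs with h h' <;> simp_all
    exact hx (le_top.trans h.ge)

theorem isCoatom_up (hc : IsCoatom c) {m : M} (hm : IsCoatom m) :
    IsCoatom (up c a m) := by
  have key : ∀ z : EdgeGlue c a, z = up c a ⊤ ∨ z ≤ up c a m ∨ ¬ up c a m ≤ z := by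
    intro z
    unfold up
    have hc' : ¬ (⊤ : K) ≤ c := fun h => hc.1 (top_le_iff.1 h)
    rcases z with z | ⟨z, hz⟩
    · by_cases h : m ≤ a
      · by_cases h' : a ≤ m
        · simp [h, h']
        · have h1 : a = ⊤ := hm.2 a (lt_of_le_not_ge h h')
          subst h1
          by_cases hz : z ≤ c
          · simp [h', hz]
          · by_cases hz' : c ≤ z
            · have h2 : z = ⊤ := hc.2 z (lt_of_le_not_ge hz' hz)
              subst h2
              simp
            · simp [h', hz']
      · simp [h]
    · by_cases h3 : z = ⊤
      · subst h3
        simp [hz]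
      by_cases h : m ≤ a
      · by_cases h' : a ≤ m
        · right; right
          simp only [h, h', dite_true, if_true, low_le_high, hc', false_or]
          intro h4
          rcases eq_or_ne m z with rfl | h5
          · exact hz h
          · exact h3 (hm.2 z (lt_of_le_of_ne ((le_antisymm h h').le.trans h4) h5))
        · have h1 : a = ⊤ := hm.2 a (lt_of_le_not_ge h h')
          subst h1
          exact absurd le_top hz
      · simp only [h, dite_false, high_le_high]
        by_cases h4 : m ≤ z
        · rcases eq_or_ne m z with rfl | h5
          · simp
          · exact absurd (hm.2 z (lt_of_le_of_ne h4 h5)) h3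
        · simp [h4]
  refine ⟨fun h => ?_, fun z hz => ?_⟩
  · replace h : up c a m = up c a ⊤ := h
    have hm' : ¬ (⊤ : M) ≤ m := fun h' => hm.1 (top_le_iff.1 h')
    have hc' : c ≠ ⊤ := hc.1
    unfold up at h
    split_ifs at h <;> simp_all
  · rcases key z with h | h | h
    · exact h
    · exact absurd h hz.not_ge
    · exact absurd hz.le h

end EdgeGlue

/-! ### Rods, snakes, and their counterparts with the edges pulled apart -/

/-- The four-element lattice `2 × 2`. -/
abbrev Square : Type := Bool × Bool

theorem Square.isCoatom : IsCoatom ((false, true) : Square) :=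
  ⟨by decide, fun b h => by revert h; rw [lt_iff_le_not_ge]; revert b; decide⟩

/-- A lattice together with its last added copy of `M₃`, sitting at the top of the lattice. -/
structure Stack where
  carrier : Type
  [lattice : Lattice carrier]
  [orderTop : OrderTop carrier]
  /-- the elements `ηₙ, αₙ, βₙ, γₙ, δₙ` of the last copy of `M₃` -/
  copy : M3 → carrier
  copy_δ : copy M3.δ = ⊤
  isCoatom_copy : ∀ x : M3, IsCoatom x → IsCoatom (copy x)

namespace Stack

attribute [instance] Stack.lattice Stack.orderTop

instance : CoeSort Stack Type := ⟨Stack.carrier⟩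

/-- The stack consisting of one copy of `M₃`. -/
def base : Stack where
  carrier := M3
  copy := id
  copy_δ := rfl
  isCoatom_copy _ h := h

/-- Glue the filter `{xₙ, δₙ}` of the stack to the ideal `{ηₙ₊₁, yₙ₊₁}` of a new copy of `M₃`,
where `x` and `y` are atoms (equivalently coatoms) of `M₃`. -/
noncomputable def glue (s : Stack) (x y : M3) (hx : IsCoatom x) : Stack where
  carrier := EdgeGlue (s.copy x) y
  copy := EdgeGlue.up (s.copy x) y
  copy_δ := rfl
  isCoatom_copy _ h := EdgeGlue.isCoatom_up (s.isCoatom_copy x hx) h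

/-- Add a new copy of `M₃` with the edges `{xₙ, δₙ}` and `{ηₙ₊₁, yₙ₊₁}` pulled apart: they are not
identified but become opposite edges of a square, with `xₙ < ηₙ₊₁` and `δₙ < yₙ₊₁`. -/
noncomputable def looseGlue (s : Stack) (x y : M3) (hx : IsCoatom x) : Stack where
  carrier := EdgeGlue (EdgeGlue.up (s.copy x) ((true, false) : Square) (false, true)) y
  copy := EdgeGlue.up _ y
  copy_δ := rfl
  isCoatom_copy _ h :=
    EdgeGlue.isCoatom_up (EdgeGlue.isCoatom_up (s.isCoatom_copy x hx) Square.isCoatom) h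

end Stack

/-- The rod `Rₙ` for `n ≥ 1` (the value at `0` is irrelevant): `R₁ = M₃`, and `Rₙ₊₁` is obtained by
glueing `{γₙ, δₙ}` to `{ηₙ₊₁, αₙ₊₁}`. -/
noncomputable def Rod : ℕ → Stack
  | 0 => Stack.base
  | 1 => Stack.base
  | n + 2 => (Rod (n + 1)).glue M3.γ M3.α M3.isCoatom_γ

open Classical in
/-- The snake `Sₙ` for `n ≥ 1` (the value at `0` is irrelevant): `S₁ = M₃`, and `Sₙ₊₁` is obtained
by glueing `{γₙ, δₙ}` to `{ηₙ₊₁, αₙ₊₁}` if `n` is odd, and `{αₙ, δₙ}` to `{ηₙ₊₁, γₙ₊₁}` if `n` is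
even. -/
noncomputable def Snake : ℕ → Stack
  | 0 => Stack.base
  | 1 => Stack.base
  | n + 2 =>
    if Odd (n + 1) then (Snake (n + 1)).glue M3.γ M3.α M3.isCoatom_γ
    else (Snake (n + 1)).glue M3.α M3.γ M3.isCoatom_α

/-- The lattice `R*ₙ` for `n ≥ 1`: the rod with the glued edges pulled apart. -/
noncomputable def RodStar : ℕ → Stack
  | 0 => Stack.base
  | 1 => Stack.base
  | n + 2 => (RodStar (n + 1)).looseGlue M3.γ M3.α M3.isCoatom_γ

open Classical in
/-- The lattice `S*ₙ` for `n ≥ 1`: the snake with the glued edges pulled apart. -/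
noncomputable def SnakeStar : ℕ → Stack
  | 0 => Stack.base
  | 1 => Stack.base
  | n + 2 =>
    if Odd (n + 1) then (SnakeStar (n + 1)).looseGlue M3.γ M3.α M3.isCoatom_γ
    else (SnakeStar (n + 1)).looseGlue M3.α M3.γ M3.isCoatom_α

end CongruenceLattices

/-! Build the lattice upwards by induction, keeping a homomorphism `h` from the current algebra `B`
onto the original `A` under which the last copy of `M₃` is the inverse image of the given copy `φ`
in `Con(A)`. Permutability is then only ever needed in `A`.

To glue `{x, δ}` to `{η, y}` with `x`, `y` complementary atoms, take the subalgebra `S` of `B × A`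
of pairs with `h b` and `a` related by `φ x`. The new `M₃` is pulled back along the second
projection, and the old lattice along the first, then met with the pullback of `φ y`. Modulo `φ x`
the two ways from `S` to `A` agree, so the coatom `c` goes to the pullback of `φ x ⊓ φ y = φ η` and
`⊤` to that of `φ y`: the edges coincide. Meets survive trivially; joins survive because `φ x` and
`φ y` permute (`comap_sup_inf`, `Realizes.glue`).

For the pulled-apart versions, the full product `B × A` first adds a square above the edge
(`Realizes.square`); its upper edge is then glued as before. -/

open FirstOrder FirstOrder.Language CategoryTheory

namespace CongruenceLattices

/-! ### Joins and inverse images of congruences -/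

section Algebras

variable {L : FirstOrder.Language.{u, v}}

namespace Congruence

section Sup

variable {A : Type w} [L.Structure A]

/-- An equivalence relation generated by a reflexive relation compatible with the operations
is compatible with the operations, since these are finitary. -/
theorem eqvGen_funMap {r : A → A → Prop}
    (hr : ∀ {n : ℕ} (f : L.Functions n) (x : Fin n → A) (i : Fin n) (a b : A), r a b →
      Relation.EqvGen r (Structure.funMap f (Function.update x i a))
        (Structure.funMap f (Function.update x i b)))
    {n : ℕ} (f : L.Functions n) (x y : Fin n → A) (h : ∀ i, Relation.EqvGen r (x i) (y i)) :
    Relation.EqvGen r (Structure.funMap f x) (Structure.funMap f y) := by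
  have one : ∀ (z : Fin n → A) (i : Fin n) (a b : A), Relation.EqvGen r a b →
      Relation.EqvGen r (Structure.funMap f (Function.update z i a))
        (Structure.funMap f (Function.update z i b)) := by
    intro z i a b hab
    induction hab with
    | rel a b hab => exact hr f z i a b hab
    | refl a => exact .refl _
    | symm a b _ ih => exact .symm _ _ ih
    | trans a b c _ _ ih₁ ih₂ => exact .trans _ _ _ ih₁ ih₂
  -- Change the arguments one coordinate at a time; finitely many changes suffice because operations
  -- are finitary.
  have key : ∀ s : Finset (Fin n),
      Relation.EqvGen r (Structure.funMap f x) (Structure.funMap f (s.piecewise y x)) := by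
    intro s
    induction s using Finset.induction_on with
    | empty => simp [Relation.EqvGen.refl]
    | insert i s hi ih =>
      refine .trans _ _ _ ih ?_
      have h₁ := one (s.piecewise y x) i (x i) (y i) (h i)
      rw [← Finset.piecewise_insert] at h₁
      rwa [Function.update_eq_self_iff.2 (by simp [hi])] at h₁
  simpa using key Finset.univ

theorem compatible_update (c : Congruence L A) {n : ℕ} (f : L.Functions n) (x : Fin n → A)
    (i : Fin n) {a b : A} (h : c.toSetoid a b) :
    c.toSetoid (Structure.funMap f (Function.update x i a))
      (Structure.funMap f (Function.update x i b)) := by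
  refine c.compatible f _ _ fun j => ?_
  by_cases hj : j = i
  · subst hj
    simpa only [Function.update_self] using h
  · simp [hj]

/-- Joins of congruences are computed as joins of equivalence relations. -/
theorem toSetoid_sup (c d : Congruence L A) :
    (c ⊔ d).toSetoid = c.toSetoid ⊔ d.toSetoid := by
  refine le_antisymm ?_ (sup_le (le_sup_left : c ≤ c ⊔ d) (le_sup_right : d ≤ c ⊔ d))
  let e : Congruence L A :=
    { toSetoid := c.toSetoid ⊔ d.toSetoid
      compatible := by
        rw [Setoid.sup_eq_eqvGen]
        intro n f x y h
        exact eqvGen_funMap (fun f x i a b hab => .rel _ _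
          (hab.imp (c.compatible_update f x i) (d.compatible_update f x i))) f x y h }
  exact (sup_le (show c ≤ e from le_sup_left (a := c.toSetoid))
    (show d ≤ e from le_sup_right (a := c.toSetoid)) : c ⊔ d ≤ e)

/-- The union of `c` and `d` is symmetric, so the join is reached by chains of forward steps. The
step also knows that `x` stays in the join class of `a`, which is what allows `x` to be lifted in
`comap_sup_inf`. -/
theorem sup_induction {c d : Congruence L A} {a : A} {p : A → Prop} (base : p a)
    (step : ∀ x y, (c ⊔ d).toSetoid a x → c.toSetoid x y ∨ d.toSetoid x y → p x → p y)
    {b : A} (h : (c ⊔ d).toSetoid a b) : p b := by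
  have h' : Relation.ReflTransGen (fun x y => c.toSetoid x y ∨ d.toSetoid x y) a b := by
    rw [toSetoid_sup, Setoid.sup_eq_eqvGen] at h
    replace h : Relation.EqvGen (fun x y => c.toSetoid x y ∨ d.toSetoid x y) a b := h
    have hs : Std.Symm (fun x y => c.toSetoid x y ∨ d.toSetoid x y) :=
      ⟨fun x y h => h.imp c.toSetoid.symm' d.toSetoid.symm'⟩
    clear base step
    induction h with
    | rel x y h => exact .single h
    | refl x => exact .refl
    | symm x y _ ih => exact Relation.ReflTransGen.stdSymm.symm _ _ ih
    | trans x y z _ _ ih₁ ih₂ => exact ih₁.trans ih₂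
  suffices (c ⊔ d).toSetoid a b ∧ p b from this.2
  clear h
  induction h' with
  | refl => exact ⟨(c ⊔ d).toSetoid.refl a, base⟩
  | tail _ hxy ih =>
    refine ⟨(c ⊔ d).toSetoid.trans ih.1 ?_, step _ _ ih.1 hxy ih.2⟩
    exact hxy.elim (fun h => (le_sup_left : c ≤ c ⊔ d) h) (fun h => (le_sup_right : d ≤ c ⊔ d) h)

/-- Each chain collapses to length two: a further `d`-step is absorbed by transitivity, and a
further `c`-step is first moved past `d`. -/
theorem Permute.exists_of_sup {c d : Congruence L A} (h : Permute c d) {a b : A}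
    (hab : (c ⊔ d).toSetoid a b) : ∃ z, c.toSetoid a z ∧ d.toSetoid z b := by
  refine sup_induction (p := fun b => ∃ z, c.toSetoid a z ∧ d.toSetoid z b)
    ⟨a, c.toSetoid.refl a, d.toSetoid.refl a⟩ ?_ hab
  rintro x y - (hxy | hxy) ⟨z, haz, hzx⟩
  · have h₁ : Relation.Comp d.toSetoid c.toSetoid z y := ⟨x, hzx, hxy⟩
    rw [← h] at h₁
    obtain ⟨t, hzt, hty⟩ := h₁
    exact ⟨t, c.toSetoid.trans haz hzt, hty⟩
  · exact ⟨z, haz, d.toSetoid.trans hzx hxy⟩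

end Sup

/-! ### Inverse images of congruences and their compatibility with joins -/

section Comap

variable {A B C : Type w} [L.Structure A] [L.Structure B] [L.Structure C]

/-- The inverse image of a congruence under a homomorphism. -/
def comap (g : B →[L] A) (c : Congruence L A) : Congruence L B where
  toSetoid := c.toSetoid.comap g
  compatible f x y h := by
    change c.toSetoid (g _) (g _)
    rw [g.map_fun, g.map_fun]
    exact c.compatible f _ _ h

theorem comap_apply {g : B →[L] A} {c : Congruence L A} {x y : B} :
    (comap g c).toSetoid x y ↔ c.toSetoid (g x) (g y) := Iff.rfl

theorem inf_apply {c d : Congruence L A} {x y : A} :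
    (c ⊓ d).toSetoid x y ↔ c.toSetoid x y ∧ d.toSetoid x y := Iff.rfl

theorem ext_iff' {c d : Congruence L A} :
    c = d ↔ ∀ x y, c.toSetoid x y ↔ d.toSetoid x y :=
  ⟨fun h _ _ => h ▸ Iff.rfl, fun h => le_antisymm (fun _ _ => (h _ _).1) (fun _ _ => (h _ _).2)⟩

theorem comap_mono (g : B →[L] A) : Monotone (comap g) :=
  fun _ _ h _ _ hxy => h hxy

theorem comap_inf (g : B →[L] A) (c d : Congruence L A) :
    comap g (c ⊓ d) = comap g c ⊓ comap g d := rfl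

theorem comap_comap (g : B →[L] A) (h : C →[L] B) (c : Congruence L A) :
    comap h (comap g c) = comap (g.comp h) c := rfl

/-- Every element related to an image under `g` by `e` is the image of an element in the same
class of `σ`. -/
def Lifts (g : B →[L] A) (e : Congruence L A) (σ : Congruence L B) : Prop :=
  ∀ (b : B) (a : A), e.toSetoid (g b) a → ∃ b', g b' = a ∧ σ.toSetoid b b'

variable {g : B →[L] A} {e c d : Congruence L A} {σ : Congruence L B}

theorem lifts_top (hg : Function.Surjective g) (e : Congruence L A) : Lifts g e ⊤ := by
  intro b a _
  obtain ⟨b', rfl⟩ := hg a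
  refine ⟨b', rfl, ?_⟩
  -- Only the maximality of `⊤` is used: it contains the total relation.
  let t : Congruence L B := ⟨⊤, fun _ _ _ _ => trivial⟩
  exact (le_top : t ≤ ⊤) (x := b) (y := b') trivial

/-- A chain of `c`- and `d`-steps from `g b` stays in one `e`-class, so each vertex lifts into the
`σ`-class of `b`. Consecutive lifts are then related by one of the two joinands on the right. -/
theorem comap_sup_inf (hl : Lifts g e σ) (hc : c ≤ e) (hd : d ≤ e) :
    comap g (c ⊔ d) ⊓ σ = (comap g c ⊓ σ) ⊔ (comap g d ⊓ σ) := by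
  apply le_antisymm
  · intro b b' h
    obtain ⟨h, hσ⟩ := inf_apply.1 h
    -- Quantifying over all lifts of a vertex lets the chain end at the prescribed `b'`.
    refine sup_induction (p := fun a => ∀ b'', g b'' = a → σ.toSetoid b b'' →
      ((comap g c ⊓ σ) ⊔ (comap g d ⊓ σ)).toSetoid b b'') ?_ ?_ (comap_apply.1 h) b' rfl hσ
    · intro b'' hb hσ
      refine (le_sup_left : comap g c ⊓ σ ≤ _) (inf_apply.2 ⟨?_, hσ⟩)
      rw [comap_apply, hb]
    · rintro x y hx hxy ih b'' rfl hσ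
      obtain ⟨b₁, rfl, hσ₁⟩ := hl b x (sup_le hc hd hx)
      refine Setoid.trans' _ (ih b₁ rfl hσ₁) ?_
      have hσ₂ := σ.toSetoid.trans (σ.toSetoid.symm hσ₁) hσ
      rcases hxy with hxy | hxy
      · exact (le_sup_left : comap g c ⊓ σ ≤ _) (inf_apply.2 ⟨hxy, hσ₂⟩)
      · exact (le_sup_right : comap g d ⊓ σ ≤ _) (inf_apply.2 ⟨hxy, hσ₂⟩)
  · exact sup_le (inf_le_inf_right _ (comap_mono g le_sup_left))
      (inf_le_inf_right _ (comap_mono g le_sup_right))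

theorem le_of_comap_inf_le (hg : Function.Surjective g) (hl : Lifts g e σ) (hc : c ≤ e)
    (h : comap g c ⊓ σ ≤ comap g d) : c ≤ d := by
  intro x y hxy
  obtain ⟨b, rfl⟩ := hg x
  obtain ⟨b', rfl, hσ⟩ := hl b y (hc hxy)
  exact h (x := b) (y := b') ⟨hxy, hσ⟩

/-- Inverse images under `g`, intersected with a congruence along which `g` lifts. -/
def comapInfHom {K : Type*} [Lattice K] [OrderTop K] (f : LatticeHom K (Congruence L A))
    (hl : Lifts g (f ⊤) σ) : LatticeHom K (Congruence L B) where
  toFun k := comap g (f k) ⊓ σ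
  map_sup' k l := by
    rw [map_sup, comap_sup_inf hl (OrderHomClass.mono f le_top) (OrderHomClass.mono f le_top)]
  map_inf' k l := by
    rw [map_inf, comap_inf, inf_inf_distrib_right]

theorem comapInfHom_apply {K : Type*} [Lattice K] [OrderTop K]
    (f : LatticeHom K (Congruence L A)) (hl : Lifts g (f ⊤) σ) (k : K) :
    comapInfHom f hl k = comap g (f k) ⊓ σ := rfl

theorem comapInfHom_injective {K : Type*} [Lattice K] [OrderTop K]
    (f : LatticeHom K (Congruence L A)) (hl : Lifts g (f ⊤) σ) (hg : Function.Surjective g)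
    (hf : Function.Injective f) : Function.Injective (comapInfHom f hl) := by
  intro k l h
  have key : ∀ {k l}, comapInfHom f hl k = comapInfHom f hl l → f k ≤ f l := fun {k l} h =>
    le_of_comap_inf_le hg hl (OrderHomClass.mono f le_top)
      ((comapInfHom_apply f hl k ▸ h.le).trans inf_le_left)
  exact hf (le_antisymm (key h) (key h.symm))

end Comap
end Congruence

/-! ### Binary products and fibre products -/

section Products

variable {A B : Type w} [L.Structure A] [L.Structure B]

/-- The direct product of two structures. -/
instance prodStructure : L.Structure (B × A) where
  funMap f x := (Structure.funMap f fun i => (x i).1, Structure.funMap f fun i => (x i).2)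
  RelMap r x := Structure.RelMap r (fun i => (x i).1) ∧ Structure.RelMap r (fun i => (x i).2)

variable [L.IsAlgebraic]

/-- A map preserving the operations is a homomorphism. -/
def homOfFun (g : B → A)
    (hg : ∀ {n : ℕ} (f : L.Functions n) (x : Fin n → B),
      g (Structure.funMap f x) = Structure.funMap f (g ∘ x)) : B →[L] A where
  toFun := g
  map_fun' := hg
  map_rel' r := isEmptyElim r

variable (L A B) in
/-- The first projection of a direct product. -/
def fstHom : B × A →[L] B := homOfFun Prod.fst fun _ _ => rfl

variable (L A B) in
/-- The second projection of a direct product. -/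
def sndHom : B × A →[L] A := homOfFun Prod.snd fun _ _ => rfl

/-- The pairs `(b, a)` such that `h b` is related to `a`. -/
def fibreProduct (h : B →[L] A) (θ : Congruence L A) : L.Substructure (B × A) where
  carrier := {p | θ.toSetoid (h p.1) p.2}
  fun_mem {n} f x hx := by
    change θ.toSetoid (h (Structure.funMap f _)) (Structure.funMap f _)
    rw [h.map_fun]
    exact θ.compatible f _ _ hx

/-- Closure is assumed for function-type products indexed in `Type w`; hence the index `ULift Bool`,
with `B × A` obtained as a homomorphic image. -/
theorem IsVariety.prod_mem {V : Set (Bundled.{w} L.Structure)} (hV : IsVariety L V)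
    (hB : Bundled.of (c := L.Structure) B ∈ V) (hA : Bundled.of (c := L.Structure) A ∈ V) :
    Bundled.of (c := L.Structure) (B × A) ∈ V := by
  let F : ULift.{w} Bool → Bundled.{w} L.Structure := fun i =>
    match i with
    | ⟨true⟩ => Bundled.of (c := L.Structure) B
    | ⟨false⟩ => Bundled.of (c := L.Structure) A
  have hF : ∀ i, F i ∈ V := by
    rintro ⟨_ | _⟩
    · exact hA
    · exact hB
  let g : (∀ i, F i) →[L] B × A :=
    homOfFun (fun x => (x ⟨true⟩, x ⟨false⟩)) fun _ _ => rfl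
  refine hV.homImage _ (hV.product _ F hF) (Bundled.of (c := L.Structure) (B × A)) g ?_
  rintro ⟨b, a⟩
  refine ⟨fun i => match i with
    | ⟨true⟩ => b
    | ⟨false⟩ => a, rfl⟩

end Products

end Algebras

/-! ### Lattice homomorphisms from a glued lattice -/

section Glue

variable {K M : Type} [Lattice K] [OrderTop K] [Lattice M] [BoundedOrder M] {c : K} {a : M}
  {T : Type*} [Lattice T]

theorem le_iff_of_injective {K T : Type*} [Lattice K] [Lattice T] (f : LatticeHom K T)
    (hf : Function.Injective f) {x y : K} : f x ≤ f y ↔ x ≤ y := by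
  rw [← inf_eq_left, ← map_inf, hf.eq_iff, inf_eq_left]

/-- Lattice embeddings of `K` and `M` which agree on the glued edge extend to the glued lattice. -/
theorem EdgeGlue.exists_latticeHom (hc : IsCoatom c) (ha : IsAtom a) (f : LatticeHom K T)
    (g : LatticeHom M T) (hf : Function.Injective f) (hg : Function.Injective g)
    (hbot : f c = g ⊥) (htop : f ⊤ = g a) :
    ∃ F : LatticeHom (EdgeGlue c a) T, Function.Injective F ∧ (∀ k, F (.low k) = f k) ∧
      ∀ m, F (EdgeGlue.up c a m) = g m := by
  classical
  have hinf : ∀ m, ¬ a ≤ m → a ⊓ m = ⊥ := fun m hm =>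
    ha.2 _ (lt_of_le_of_ne inf_le_left fun h => hm (inf_eq_left.1 h))
  let F : EdgeGlue c a → T := fun z => match z with
    | .low k => f k
    | .high m _ => g m
  have hup : ∀ m, F (EdgeGlue.up c a m) = g m := by
    intro m
    unfold EdgeGlue.up
    split_ifs with h h'
    · rw [le_antisymm h h', ← htop]
    · rw [← inf_eq_right.2 h, hinf m h', ← hbot]
    · rfl
  -- If `k ≰ c`, then `k ⊔ c = ⊤`; as `g m` already absorbs `f c = g ⊥`, joining with `f k` amounts
  -- to joining with `f ⊤ = g a`. The formula for meets is dual, with `a ⊓ m = ⊥`.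
  have hsup : ∀ (k : K) (m : M), f k ⊔ g m = g ((if k ≤ c then ⊥ else a) ⊔ m) := by
    intro k m
    split_ifs with h
    · rw [bot_sup_eq, sup_eq_right]
      exact (OrderHomClass.mono f h).trans (hbot.le.trans (OrderHomClass.mono g bot_le))
    · have hk : k ⊔ c = ⊤ := hc.2 _ (lt_of_le_of_ne le_sup_right fun h' =>
        h (le_sup_left.trans h'.ge))
      rw [map_sup, ← htop, ← hk, map_sup, sup_assoc, hbot, ← map_sup, bot_sup_eq]
  have hmeet : ∀ (k : K) (m : M), f k ⊓ g m = f (k ⊓ if a ≤ m then ⊤ else c) := by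
    intro k m
    split_ifs with h
    · rw [inf_top_eq, inf_eq_left]
      exact (OrderHomClass.mono f le_top).trans (htop.le.trans (OrderHomClass.mono g h))
    · rw [map_inf, hbot, ← hinf m h, map_inf, ← htop, ← inf_assoc, ← map_inf, inf_top_eq]
  refine ⟨⟨⟨F, ?_⟩, ?_⟩, ?_, fun _ => rfl, hup⟩
  · rintro (k | ⟨m, hm⟩) (l | ⟨n, hn⟩)
    · exact map_sup f k l
    · exact (hsup k n).symm
    · exact ((sup_comm _ _).trans (hsup l m)).symm
    · exact map_sup g m n
  · rintro (k | ⟨m, hm⟩) (l | ⟨n, hn⟩)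
    · exact map_inf f k l
    · exact (hmeet k n).symm
    · exact ((inf_comm _ _).trans (hmeet l m)).symm
    · exact (hup _).trans (map_inf g m n)
  · have hne : ∀ (k : K) (m : M), ¬ m ≤ a → f k ≠ g m := fun k m hm h =>
      hm ((le_iff_of_injective g hg).1 (h ▸ htop ▸ OrderHomClass.mono f le_top))
    rintro (k | ⟨m, hm⟩) (l | ⟨n, hn⟩) h
    · exact congrArg _ (hf h)
    · exact absurd h (hne k n hn)
    · exact absurd h.symm (hne l m hm)
    · cases hg h
      rfl

/-- Two incomparable elements of a lattice generate a four-element sublattice. -/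
theorem Square.exists_latticeHom {q r : T} (hqr : ¬ q ≤ r) (hrq : ¬ r ≤ q) :
    ∃ F : LatticeHom Square T, Function.Injective F ∧ F ⊥ = q ⊓ r ∧ F (true, false) = q ∧
      F (false, true) = r ∧ F ⊤ = q ⊔ r := by
  let F : Square → T := fun z => match z with
    | (false, false) => q ⊓ r
    | (true, false) => q
    | (false, true) => r
    | (true, true) => q ⊔ r
  have hle : q ⊓ r ≤ q ⊔ r := inf_le_left.trans le_sup_left
  have h₁ : ∀ x y, F (x ⊔ y) = F x ⊔ F y := by
    rintro ⟨_ | _, _ | _⟩ ⟨_ | _, _ | _⟩ <;> simp [F, sup_comm, hle]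
  have h₂ : ∀ x y, F (x ⊓ y) = F x ⊓ F y := by
    rintro ⟨_ | _, _ | _⟩ ⟨_ | _, _ | _⟩ <;> simp [F, inf_comm, hle]
  refine ⟨⟨⟨F, h₁⟩, h₂⟩, ?_, rfl, rfl, rfl, rfl⟩
  -- Whether `F x` lies above `q` and above `r` determines the two coordinates of `x`.
  have hq : ∀ x, q ≤ F x ↔ x.1 = true := by
    rintro ⟨_ | _, _ | _⟩ <;> simp [F, hqr]
  have hr : ∀ x, r ≤ F x ↔ x.2 = true := by
    rintro ⟨_ | _, _ | _⟩ <;> simp [F, hrq]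
  intro x y (h : F x = F y)
  exact Prod.ext (Bool.eq_iff_iff.2 (by rw [← hq, ← hq, h]))
    (Bool.eq_iff_iff.2 (by rw [← hr, ← hr, h]))

end Glue

/-! ### Realizing glued lattices in a variety -/

section Realize

variable {L : FirstOrder.Language.{u, v}} {V : Set (Bundled.{w} L.Structure)} {A : Type w}
  [L.Structure A] {φ : LatticeHom M3 (Congruence L A)}

open Congruence

/-- `K` embeds into the congruence lattice of an algebra `B` in `V` with a homomorphism onto `A`,
such that `k` corresponds to the inverse image of `φ m` for all pairs `(k, m)` in `r`. -/
def Realizes (V : Set (Bundled.{w} L.Structure)) (φ : LatticeHom M3 (Congruence L A)) {K : Type}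
    [Lattice K] (r : Set (K × M3)) : Prop :=
  ∃ (B : Type w) (_ : L.Structure B), Bundled.of (c := L.Structure) B ∈ V ∧
    ∃ h : B →[L] A, Function.Surjective h ∧ ∃ f : LatticeHom K (Congruence L B),
      Function.Injective f ∧ ∀ p ∈ r, f p.1 = comap h (φ p.2)

variable {K : Type} [Lattice K]

theorem Realizes.mono {r s : Set (K × M3)} (h : Realizes V φ s) (hrs : r ⊆ s) :
    Realizes V φ r := by
  obtain ⟨B, _, hB, h, hh, f, hf, hp⟩ := h
  exact ⟨B, _, hB, h, hh, f, hf, fun p hpr => hp p (hrs hpr)⟩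

theorem Realizes.admits {r : Set (K × M3)} (h : Realizes V φ r) : Admits V K := by
  obtain ⟨B, _, hB, -, -, f, hf, -⟩ := h
  exact ⟨_, hB, f, hf⟩

/-- An empty structure has a single congruence. Nonemptiness is needed since varieties are closed
only under nonempty subalgebras. -/
theorem nonempty_of_injective (hφ : Function.Injective φ) : Nonempty A := by
  by_contra hA
  rw [not_nonempty_iff] at hA
  have : φ M3.η = φ M3.δ := ext_iff'.2 fun x => isEmptyElim x
  exact absurd (hφ this) (by decide)

variable [OrderTop K] [L.IsAlgebraic] {c : K} {x y : M3}

/-- The edge `{x, δ}` of a realized lattice can be glued to the edge `{η, y}` of `M₃`. -/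
theorem Realizes.glue (hV : IsVariety L V) (hA : Bundled.of (c := L.Structure) A ∈ V)
    (hφ : Function.Injective φ) (hperm : ∀ m n, Permute (φ m) (φ n)) (hc : IsCoatom c)
    (hy : IsAtom y) (hxy : IsCompl x y) (hr : Realizes V φ {(c, x), (⊤, ⊤)}) :
    Realizes V φ (Set.range fun m => (EdgeGlue.up c y m, m)) := by
  obtain ⟨B, _, hB, h, hh, f, hf, hp⟩ := hr
  have hfc : f c = comap h (φ x) := hp (c, x) (by simp)
  have hft : f ⊤ = comap h (φ ⊤) := hp (⊤, ⊤) (by simp)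
  let S := fibreProduct h (φ x)
  let g₁ : S →[L] B := (fstHom L A B).comp S.subtype.toHom
  let g₂ : S →[L] A := (sndHom L A B).comp S.subtype.toHom
  have hS : ∀ s : S, (φ x).toSetoid (h (g₁ s)) (g₂ s) := fun s => s.2
  have hST : ∀ s : S, (φ ⊤).toSetoid (h (g₁ s)) (g₂ s) := fun s =>
    (OrderHomClass.mono φ le_top : φ x ≤ φ ⊤) (hS s)
  have hg₁ : Function.Surjective g₁ := fun b =>
    ⟨⟨(b, h b), (φ x).toSetoid.refl (h b)⟩, rfl⟩
  have hg₂ : Function.Surjective g₂ := fun a => by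
    obtain ⟨b, rfl⟩ := hh a
    exact ⟨⟨(b, h b), (φ x).toSetoid.refl (h b)⟩, rfl⟩
  obtain ⟨a₀⟩ := nonempty_of_injective hφ
  obtain ⟨s₀, -⟩ := hg₂ a₀
  have hmono : ∀ {m n}, m ≤ n → φ m ≤ φ n := fun h => OrderHomClass.mono φ h
  -- The only use of permutability: `φ ⊤ = φ x ⊔ φ y` yields `a` with `h b` related to `a` by `φ x`,
  -- so that `(b, a)` lies in `S`, and `a` related to `g₂ s` by `φ y`.
  have hl₁ : Lifts g₁ (f ⊤) (comap g₂ (φ y)) := by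
    intro s b hsb
    rw [hft, comap_apply] at hsb
    have h₁ : (φ x ⊔ φ y).toSetoid (h b) (g₂ s) := by
      rw [← map_sup, hxy.sup_eq_top]
      exact Setoid.trans' _ (Setoid.symm' _ hsb) (hmono le_top (hS s))
    obtain ⟨a, ha, ha'⟩ := (hperm x y).exists_of_sup h₁
    exact ⟨⟨(b, a), ha⟩, rfl, Setoid.symm' _ ha'⟩
  have hl₂ : Lifts g₂ (φ ⊤) ⊤ := lifts_top hg₂ _
  obtain ⟨F, hF, -, hup⟩ := EdgeGlue.exists_latticeHom hc hy (comapInfHom f hl₁)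
    (comapInfHom φ hl₂) (comapInfHom_injective f hl₁ hg₁ hf)
    (comapInfHom_injective φ hl₂ hg₂ hφ)
    (by
      -- By `hS`, `φ x` has the same inverse image along `h ∘ g₁` and `g₂`; meeting with that of `φ
      -- y` leaves that of `φ ⊥`.
      rw [comapInfHom_apply, comapInfHom_apply, inf_top_eq, hfc, ext_iff']
      intro s t
      rw [inf_apply, comap_apply, comap_apply, comap_apply, comap_apply]
      constructor
      · rintro ⟨h₁, h₂⟩
        rw [← hxy.inf_eq_bot, map_inf]
        exact ⟨Setoid.trans' _ (Setoid.symm' _ (hS s)) (Setoid.trans' _ h₁ (hS t)), h₂⟩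
      · intro h₁
        exact ⟨Setoid.trans' _ (hS s) (Setoid.trans' _ (hmono bot_le h₁)
          (Setoid.symm' _ (hS t))), hmono bot_le h₁⟩)
    (by
      rw [comapInfHom_apply, comapInfHom_apply, inf_top_eq, hft, inf_eq_right]
      intro s t h₁
      have h₂ : (φ ⊤).toSetoid (g₂ s) (g₂ t) := (hmono le_top : φ y ≤ φ ⊤) h₁
      exact (φ ⊤).toSetoid.trans (hST s)
        ((φ ⊤).toSetoid.trans h₂ ((φ ⊤).toSetoid.symm (hST t))))
  refine ⟨S, inferInstance, hV.subalgebra _ (hV.prod_mem hB hA) S ⟨s₀⟩, g₂, hg₂, F, hF, ?_⟩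
  rintro _ ⟨m, rfl⟩
  change F (EdgeGlue.up c y m) = comap g₂ (φ m)
  rw [hup, comapInfHom_apply, inf_top_eq]

/-- The edge `{c, ⊤}` of a realized lattice can be extended upwards to a square. -/
theorem Realizes.square (hV : IsVariety L V) (hA : Bundled.of (c := L.Structure) A ∈ V)
    (hφ : Function.Injective φ) (hc : IsCoatom c) (hr : Realizes V φ {(c, x), (⊤, ⊤)}) :
    Realizes V φ {(EdgeGlue.up c ((true, false) : Square) (false, true), x), (⊤, ⊤)} := by
  obtain ⟨B, _, hB, h, hh, f, hf, hp⟩ := hr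
  have hfc : f c = comap h (φ x) := hp (c, x) (by simp)
  have hft : f ⊤ = comap h (φ ⊤) := hp (⊤, ⊤) (by simp)
  have hle : f c ≤ f ⊤ := OrderHomClass.mono f le_top
  obtain ⟨a₀⟩ := nonempty_of_injective hφ
  obtain ⟨b₀, -⟩ := hh a₀
  let g₁ : B × A →[L] B := fstHom L A B
  let g₂ : B × A →[L] A := sndHom L A B
  have hg₁ : Function.Surjective g₁ := fun b => ⟨(b, a₀), rfl⟩
  -- In the full product the second coordinate can simply be kept, so no permutability is needed.
  have hl : Lifts g₁ (f ⊤) (comap g₂ (φ ⊥)) := fun s b _ =>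
    ⟨(b, s.2), rfl, Setoid.refl' _ s.2⟩
  obtain ⟨G, hG, hGbot, hGq, hGr, hGtop⟩ := Square.exists_latticeHom
    (q := comapInfHom f hl ⊤) (r := comap g₁ (f c))
    (fun h₁ => hc.1 (hf (le_antisymm hle (le_of_comap_inf_le hg₁ hl le_rfl h₁))))
    -- `r` ignores the second coordinate, whereas pairs in `q` have second coordinates related by `φ
    -- ⊥`.
    (fun h₁ => by
      have h₂ : φ ⊤ ≤ φ ⊥ := fun a a' _ =>
        (h₁ (x := (b₀, a)) (y := (b₀, a')) (Setoid.refl' _ b₀)).2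
      exact absurd ((le_iff_of_injective φ hφ).1 h₂) (by decide))
  obtain ⟨F, hF, -, hup⟩ := EdgeGlue.exists_latticeHom hc
    (a := ((true, false) : Square)) (by
      refine ⟨by decide, fun z hz => ?_⟩
      revert hz
      rw [lt_iff_le_not_ge]
      revert z
      decide) (comapInfHom f hl) G (comapInfHom_injective f hl hg₁ hf) hG
    (by
      rw [hGbot, comapInfHom_apply, comapInfHom_apply, inf_right_comm, inf_comm (comap g₁ (f ⊤)),
        inf_eq_left.2 (comap_mono g₁ hle)])
    hGq.symm
  -- The map onto `A` goes through `B`, so the upper edge `r < q ⊔ r` is again the inverse image of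
  -- `φ x < φ ⊤`.
  refine ⟨B × A, inferInstance, hV.prod_mem hB hA, h.comp g₁, hh.comp hg₁, F, hF, ?_⟩
  rintro _ (rfl | rfl)
  · change F (EdgeGlue.up _ _ _) = comap _ (φ x)
    rw [hup, hGr, hfc, comap_comap]
  · change F (EdgeGlue.up _ _ ⊤) = comap _ (φ ⊤)
    rw [hup, hGtop, ← comap_comap, ← hft]
    refine le_antisymm (sup_le inf_le_left (comap_mono g₁ hle)) ?_
    rintro ⟨b, a⟩ ⟨b', a'⟩ h₁
    -- Move the first coordinate by `q`, then the second by `r`.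
    refine Setoid.trans' _ (y := (b', a)) ?_ ?_
    · exact (le_sup_left : comapInfHom f hl ⊤ ≤ _ ⊔ comap g₁ (f c)) (x := (b, a)) (y := (b', a))
        ⟨h₁, Setoid.refl' _ a⟩
    · exact (le_sup_right : comap g₁ (f c) ≤ comapInfHom f hl ⊤ ⊔ _) (x := (b', a))
        (y := (b', a')) (Setoid.refl' _ b')

/-! ### Realization of stacks and the induction -/

/-- A stack is realized if its last copy of `M₃` is the inverse image of the sublattice `φ`. -/
def Stack.IsRealized (V : Set (Bundled.{w} L.Structure)) (φ : LatticeHom M3 (Congruence L A))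
    (s : Stack) : Prop :=
  Realizes V φ (Set.range fun m => (s.copy m, m))

omit [L.IsAlgebraic] in
theorem Stack.isRealized_base (hA : Bundled.of (c := L.Structure) A ∈ V)
    (hφ : Function.Injective φ) : Stack.base.IsRealized V φ := by
  refine ⟨A, inferInstance, hA, Hom.id L A, Function.surjective_id, φ, hφ, ?_⟩
  rintro _ ⟨m, rfl⟩
  rfl

omit [L.IsAlgebraic] in
theorem Stack.IsRealized.edge {s : Stack} (hs : s.IsRealized V φ) (x : M3) :
    Realizes V φ {(s.copy x, x), (⊤, ⊤)} := by
  refine Realizes.mono hs ?_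
  rintro _ (rfl | rfl)
  · exact ⟨x, rfl⟩
  · exact ⟨M3.δ, by simp only [s.copy_δ]; rfl⟩

theorem Stack.IsRealized.glue (hV : IsVariety L V) (hA : Bundled.of (c := L.Structure) A ∈ V)
    (hφ : Function.Injective φ) (hperm : ∀ m n, Permute (φ m) (φ n)) {s : Stack}
    (hs : s.IsRealized V φ) (hx : IsCoatom x) (hy : IsAtom y) (hxy : IsCompl x y) :
    (s.glue x y hx).IsRealized V φ :=
  Realizes.glue hV hA hφ hperm (s.isCoatom_copy x hx) hy hxy (hs.edge x)

theorem Stack.IsRealized.looseGlue (hV : IsVariety L V)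
    (hA : Bundled.of (c := L.Structure) A ∈ V) (hφ : Function.Injective φ)
    (hperm : ∀ m n, Permute (φ m) (φ n)) {s : Stack} (hs : s.IsRealized V φ) (hx : IsCoatom x)
    (hy : IsAtom y) (hxy : IsCompl x y) : (s.looseGlue x y hx).IsRealized V φ :=
  Realizes.glue hV hA hφ hperm
    (EdgeGlue.isCoatom_up (s.isCoatom_copy x hx) Square.isCoatom) hy hxy
    (Realizes.square hV hA hφ (s.isCoatom_copy x hx) (hs.edge x))

theorem M3.isAtom_α : IsAtom M3.α :=
  ⟨by decide, fun b h => by revert h; rw [lt_iff_le_not_ge]; revert b; decide⟩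

theorem M3.isAtom_γ : IsAtom M3.γ :=
  ⟨by decide, fun b h => by revert h; rw [lt_iff_le_not_ge]; revert b; decide⟩

theorem M3.isCompl_γ_α : IsCompl M3.γ M3.α :=
  IsCompl.of_eq (by decide) (by decide)

end Realize
end CongruenceLattices

theorem theorem4 {L : FirstOrder.Language.{u, v}} [L.IsAlgebraic]
    (V : Set (CategoryTheory.Bundled.{w} L.Structure))
    (hV : CongruenceLattices.IsVariety L V)
    (hM3 : ∃ A ∈ V, ∃ f : LatticeHom CongruenceLattices.M3 (CongruenceLattices.Congruence L A),
      Function.Injective f ∧ ∀ x y, CongruenceLattices.Congruence.Permute (f x) (f y))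
    (n : ℕ) (hn : 1 ≤ n) :
    CongruenceLattices.Admits V (CongruenceLattices.Rod n) ∧
    CongruenceLattices.Admits V (CongruenceLattices.Snake n) ∧
    CongruenceLattices.Admits V (CongruenceLattices.RodStar n) ∧
    CongruenceLattices.Admits V (CongruenceLattices.SnakeStar n) := by
  obtain ⟨A, hA, φ, hφ, hperm⟩ := hM3
  have base := CongruenceLattices.Stack.isRealized_base hA hφ
  have glue := fun s (hs : CongruenceLattices.Stack.IsRealized V φ s) {x y} =>
    hs.glue (x := x) (y := y) hV hA hφ hperm
  have looseGlue := fun s (hs : CongruenceLattices.Stack.IsRealized V φ s) {x y} =>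
    hs.looseGlue (x := x) (y := y) hV hA hφ hperm
  have hγα := CongruenceLattices.M3.isCompl_γ_α
  have key : (CongruenceLattices.Rod n).IsRealized V φ ∧
      (CongruenceLattices.Snake n).IsRealized V φ ∧
      (CongruenceLattices.RodStar n).IsRealized V φ ∧
      (CongruenceLattices.SnakeStar n).IsRealized V φ := by
    induction n, hn using Nat.le_induction with
    | base => exact ⟨base, base, base, base⟩
    | succ n hn ih =>
      -- The families recurse at `k + 2`, so `n` must have the form `k + 1`.
      obtain ⟨k, rfl⟩ := Nat.exists_eq_add_of_le' hn
      obtain ⟨h₁, h₂, h₃, h₄⟩ := ih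
      refine ⟨?_, ?_, ?_, ?_⟩
      · exact glue _ h₁ _ CongruenceLattices.M3.isAtom_α hγα
      · rw [CongruenceLattices.Snake]
        split_ifs
        · exact glue _ h₂ _ CongruenceLattices.M3.isAtom_α hγα
        · exact glue _ h₂ _ CongruenceLattices.M3.isAtom_γ hγα.symm
      · exact looseGlue _ h₃ _ CongruenceLattices.M3.isAtom_α hγα
      · rw [CongruenceLattices.SnakeStar]
        split_ifs
        · exact looseGlue _ h₄ _ CongruenceLattices.M3.isAtom_α hγα
        · exact looseGlue _ h₄ _ CongruenceLattices.M3.isAtom_γ hγα.symm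
  exact ⟨key.1.admits, key.2.1.admits, key.2.2.1.admits, key.2.2.2.admits⟩
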